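/- Let $\mathcal N,\mathcal M$ be von Neumann algebras with faithful normal states $\rho,\phi$. Let $\mathcal N\bar\otimes\mathcal M$ be their von Neumann algebra tensor product, that is, the von Neumann algebra generated by the operators $\pi_\rho(a)\otimes\pi_\phi(b)$ ($a\in\mathcal N$, $b\in\mathcal M$) on the Hilbert space tensor product of the GNS spaces of $\rho$ and $\phi$, equipped with the product state $\rho\otimes\phi$. We write $a\otimes b$ for $\pi_\rho(a)\otimes\pi_\phi(b)$. For an algebra $\mathcal A$ with a state $\omega$, let $\mathcal A_\sharp$ be the completion of $\mathcal A$ in the norm $\|x\|_\sharp=\|\omega(\,\cdot\,x)\|_{\mathcal A^*}$. Thus we have the Banach spaces $\mathcal N_\sharp$, $\mathcal M_\sharp$ and $(\mathcal N\bar\otimes\mathcal M)_\sharp$, formed with $\rho$, $\phi$ and $\rho\otimes\phi$ respectively. Let $\mathcal E_{\mathcal N}$ and $\mathcal E_{\mathcal M}$ be the $\rho\otimes\phi$-preserving conditional expectations of $\mathcal N\bar\otimes\mathcal M$ onto $\mathcal N\otimes 1$ and $1\otimes\mathcal M$; on elementary tensors $\mathcal E_{\mathcal N}(a\otimes b)=\phi(b)\,a\otimes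 1$ and $\mathcal E_{\mathcal M}(a\otimes b)=\rho(a)\,1\otimes b$. Let $(x_j)_{j\ge1}\subseteq\mathcal N$ and $(y_k)_{k\ge1}\subseteq\mathcal M$ be sequences with $\rho(x_j^*x_k)=\delta_{jk}$ and $\phi(y_j^*y_k)=\delta_{jk}$ for all $j,k\ge1$, which are Schauder bases of $\mathcal N_\sharp$ and $\mathcal M_\sharp$ respectively. Let $E_j$ and $D_k$ be the bounded operators on $(\mathcal N\bar\otimes\mathcal M)_\sharp$ that extend $$E_j z=(x_j\otimes 1)\,\mathcal E_{\mathcal M}\big((x_j\otimes 1)^*z\big),\qquad D_k z=(1\otimes y_k)\,\mathcal E_{\mathcal N}\big((1\otimes y_k)^*z\big),\qquad z\in\mathcal N\bar\otimes\mathcal M.$$ Suppose that $(E_j)_{j\ge1}$ and $(D_k)_{k\ge1}$ are both Schauder decompositions of $X=(\mathcal N\bar\otimes\mathcal M)_\sharp$; here a sequence $(P_j)_{j\ge1}$ of bounded projections on $X$ is a Schauder decomposition if $P_jP_k=0$ for $j\ne k$ and $\sum_{j=1}^\infty P_jz=z$ in norm for every $z\in X$. Define the shell enumeration, a bijection from pairs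 $(j,k)$ with $j,k\ge1$ to the positive integers, by $s(j,k)=(k-1)^2+j$ if $j\le k$ and $s(j,k)=j^2-k+1$ if $j>k$. Then the sequence $(z_s)_{s\ge1}$ given by $z_{s(j,k)}=x_j\otimes y_k$ is a Schauder basis of $(\mathcal N\bar\otimes\mathcal M)_\sharp$. -/

import Mathlib

open scoped ComplexOrder TensorProduct InnerProductSpace

set_option linter.unusedSectionVars false

noncomputable section

namespace VNTensor

/-! ### The left predual

For a functional `ω` on an algebra `A`, the norm `‖x‖_♯` is the norm in the dual of `A` of the
functional `xω = ω(· x)`, and `A_♯` is the completion of `A` for that norm. -/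

section Sharp

variable {A : Type*} [NormedRing A] [NormedAlgebra ℂ A]

/-- The left embedding `x ↦ xω = ω(· x)` of `A` in its dual. -/
def leftEmbed (ω : A →L[ℂ] ℂ) : A →ₗ[ℂ] StrongDual ℂ A where
  toFun x := ω.comp ((ContinuousLinearMap.mul ℂ A).flip x)
  map_add' x y := by ext; simp
  map_smul' c x := by ext; simp

@[simp] theorem leftEmbed_apply (ω : A →L[ℂ] ℂ) (x y : A) : leftEmbed ω x y = ω (y * x) := rfl

/-- A copy of `A`, to carry the (semi)norm `‖x‖_♯ = ‖xω‖`. -/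
@[nolint unusedArguments]
def PreSharp (_ω : A →L[ℂ] ℂ) : Type _ := A

instance (ω : A →L[ℂ] ℂ) : AddCommGroup (PreSharp ω) := inferInstanceAs (AddCommGroup A)

instance (ω : A →L[ℂ] ℂ) : Module ℂ (PreSharp ω) := inferInstanceAs (Module ℂ A)

/-- The identity map from `A` to its copy. -/
def toPreSharp (ω : A →L[ℂ] ℂ) : A ≃ₗ[ℂ] PreSharp ω := LinearEquiv.refl ℂ A

instance (ω : A →L[ℂ] ℂ) : SeminormedAddCommGroup (PreSharp ω) :=
  SeminormedAddCommGroup.induced (PreSharp ω) (StrongDual ℂ A)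
    ((leftEmbed ω).comp (toPreSharp ω).symm.toLinearMap)

instance (ω : A →L[ℂ] ℂ) : NormedSpace ℂ (PreSharp ω) :=
  NormedSpace.induced ℂ (PreSharp ω) (StrongDual ℂ A)
    ((leftEmbed ω).comp (toPreSharp ω).symm.toLinearMap)

theorem norm_toPreSharp (ω : A →L[ℂ] ℂ) (x : A) : ‖toPreSharp ω x‖ = ‖leftEmbed ω x‖ := rfl

/-- The left predual `A_♯`: the completion of `A` for the norm `‖·‖_♯`. -/
abbrev Sharp (ω : A →L[ℂ] ℂ) : Type _ := UniformSpace.Completion (PreSharp ω)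

/-- The canonical map `A → A_♯`. -/
def toSharp (ω : A →L[ℂ] ℂ) (x : A) : Sharp ω := (toPreSharp ω x : PreSharp ω)

/-- The extension to `A_♯` of a linear map on `A` that is bounded for `‖·‖_♯`. -/
def extendSharp (ω : A →L[ℂ] ℂ) (T : A →ₗ[ℂ] A)
    (hT : ∃ C : ℝ, ∀ x, ‖leftEmbed ω (T x)‖ ≤ C * ‖leftEmbed ω x‖) : Sharp ω →L[ℂ] Sharp ω :=
  (LinearMap.mkContinuousOfExistsBound
    ((toPreSharp ω).toLinearMap.comp (T.comp (toPreSharp ω).symm.toLinearMap)) hT).completion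

theorem extendSharp_toSharp (ω : A →L[ℂ] ℂ) (T : A →ₗ[ℂ] A)
    (hT : ∃ C : ℝ, ∀ x, ‖leftEmbed ω (T x)‖ ≤ C * ‖leftEmbed ω x‖) (x : A) :
    extendSharp ω T hT (toSharp ω x) = toSharp ω (T x) :=
  ContinuousLinearMap.completion_apply_coe _ _

theorem norm_leftEmbed_mul_le (ω : A →L[ℂ] ℂ) (a x : A) :
    ‖leftEmbed ω (a * x)‖ ≤ ‖a‖ * ‖leftEmbed ω x‖ := by
  refine ContinuousLinearMap.opNorm_le_bound _ (by positivity) fun y => ?_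
  have h := (leftEmbed ω x).le_opNorm (y * a)
  simp only [leftEmbed_apply] at h ⊢
  rw [← mul_assoc]
  calc _ ≤ _ := h
    _ ≤ ‖leftEmbed ω x‖ * (‖y‖ * ‖a‖) := by gcongr; exact norm_mul_le _ _
    _ = _ := by ring

/-- A map `E` with a bounded `ω`-adjoint is bounded for `‖·‖_♯`. -/
theorem norm_leftEmbed_le_of_adjoint (ω : A →L[ℂ] ℂ) (E F : A → A)
    (h : ∀ x y, ω (y * E x) = ω (F y * x)) (C : ℝ) (hC : 0 ≤ C) (hF : ∀ y, ‖F y‖ ≤ C * ‖y‖)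
    (x : A) : ‖leftEmbed ω (E x)‖ ≤ C * ‖leftEmbed ω x‖ := by
  refine ContinuousLinearMap.opNorm_le_bound _ (by positivity) fun y => ?_
  have h' := (leftEmbed ω x).le_opNorm (F y)
  simp only [leftEmbed_apply] at h' ⊢
  rw [h]
  calc _ ≤ _ := h'
    _ ≤ ‖leftEmbed ω x‖ * (C * ‖y‖) := by gcongr; exact hF y
    _ = _ := by ring

/-- If `E` has a bounded `ω`-adjoint, then `z ↦ u E(v z)` is bounded for `‖·‖_♯`. -/
theorem exists_bound_mul_mul (ω : A →L[ℂ] ℂ) (E F : A → A)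
    (h : ∀ x y, ω (y * E x) = ω (F y * x)) (C : ℝ) (hC : 0 ≤ C) (hF : ∀ y, ‖F y‖ ≤ C * ‖y‖)
    (u v : A) : ∃ C' : ℝ, ∀ z, ‖leftEmbed ω (u * E (v * z))‖ ≤ C' * ‖leftEmbed ω z‖ := by
  refine ⟨‖u‖ * (C * ‖v‖), fun z => ?_⟩
  calc _ ≤ ‖u‖ * ‖leftEmbed ω (E (v * z))‖ := norm_leftEmbed_mul_le _ _ _
    _ ≤ ‖u‖ * (C * ‖leftEmbed ω (v * z)‖) := by
      gcongr; exact norm_leftEmbed_le_of_adjoint ω E F h C hC hF _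
    _ ≤ ‖u‖ * (C * (‖v‖ * ‖leftEmbed ω z‖)) := by
      gcongr; exact norm_leftEmbed_mul_le _ _ _
    _ = _ := by ring

end Sharp

/-! ### Bases, decompositions, states -/

/-- The sequence `x` is a Schauder basis of `X`. -/
def IsSchauderBasis {X : Type*} [NormedAddCommGroup X] [NormedSpace ℂ X] (x : ℕ → X) : Prop :=
  ∃ b : SchauderBasis ℂ X, ⇑b = x

/-- The sequence `D` of bounded operators is a Schauder decomposition of `X`: projections with
`D j D k = 0` for `j ≠ k` such that `∑ D j x` converges to `x` in norm for every `x`. -/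
structure IsSchauderDecomposition {X : Type*} [NormedAddCommGroup X] [NormedSpace ℂ X]
    (D : ℕ → X →L[ℂ] X) : Prop where
  proj : ∀ j, D j ∘L D j = D j
  disjoint : ∀ j k, j ≠ k → D j ∘L D k = 0
  expansion : ∀ x, Filter.Tendsto (fun n => ∑ j ∈ Finset.range n, D j x) Filter.atTop (nhds x)

/-- Faithful normal states; normality is preservation of suprema of upward directed sets. -/
structure IsFaithfulNormalState {N : Type*} [CStarAlgebra N] [PartialOrder N] [StarOrderedRing N]
    (ρ : N →ₚ[ℂ] ℂ) : Prop where
  map_one : ρ 1 = 1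
  faithful : ∀ a, ρ (star a * a) = 0 → a = 0
  normal : ScottContinuous ρ

/-- The continuous functional underlying a positive functional. -/
def toCLM {N : Type*} [CStarAlgebra N] [PartialOrder N] [StarOrderedRing N]
    (ρ : N →ₚ[ℂ] ℂ) : N →L[ℂ] ℂ where
  toFun := ρ
  map_add' := map_add ρ
  map_smul' c x := map_smul ρ c x
  cont := map_continuous ρ

/-! ### The shell enumeration -/

/-- The shell enumeration of the pairs `(j, k)`, with indices and numbers starting from `0`. -/
def shell (p : ℕ × ℕ) : ℕ :=
  if p.1 ≤ p.2 then p.2 ^ 2 + p.1 else (p.1 + 1) ^ 2 - (p.2 + 1)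

/-- With indices and numbers starting from `1`, the shell enumeration sends `(j, k)` to
`(k - 1) ^ 2 + j` if `j ≤ k` and to `j ^ 2 - k + 1` if `j > k`. -/
theorem shell_pred_pred (j k : ℕ) (hj : 1 ≤ j) (hk : 1 ≤ k) :
    shell (j - 1, k - 1) + 1 = if j ≤ k then (k - 1) ^ 2 + j else j ^ 2 - k + 1 := by
  obtain ⟨j, rfl⟩ := Nat.exists_eq_add_of_le' hj
  obtain ⟨k, rfl⟩ := Nat.exists_eq_add_of_le' hk
  by_cases h : j ≤ k <;> simp [shell, h, add_assoc]

/-- The inverse of the shell enumeration. -/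
def unshell (s : ℕ) : ℕ × ℕ :=
  if s - s.sqrt ^ 2 ≤ s.sqrt then (s - s.sqrt ^ 2, s.sqrt)
  else (s.sqrt, 2 * s.sqrt - (s - s.sqrt ^ 2))

/-- The shell enumeration as a bijection. -/
def shellEquiv : ℕ × ℕ ≃ ℕ where
  toFun := shell
  invFun := unshell
  left_inv := by
    rintro ⟨j, k⟩
    unfold shell
    by_cases h : j ≤ k
    · have hs : k = (k ^ 2 + j).sqrt := Nat.eq_sqrt'.2 ⟨by omega, by nlinarith⟩
      simp [h, unshell, ← hs]
    · have e : (j + 1) ^ 2 - (k + 1) = j ^ 2 + (2 * j - k) := by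
        have : (j + 1) ^ 2 = j ^ 2 + (2 * j - k) + (k + 1) := by
          have : 2 * j - k + k = 2 * j := by omega
          linear_combination -this
        omega
      have hs : j = (j ^ 2 + (2 * j - k)).sqrt :=
        Nat.eq_sqrt'.2 ⟨by omega, by have : 2 * j - k ≤ 2 * j := by omega
                                     nlinarith⟩
      have h1 : ¬ (2 * j - k ≤ j) := by omega
      have h2 : 2 * j - (2 * j - k) = k := by omega
      simp [h, e, unshell, ← hs, h1, h2]
  right_inv := by
    intro s
    obtain ⟨h1, h2⟩ := Nat.eq_sqrt'.1 (rfl : s.sqrt = s.sqrt)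
    unfold unshell
    generalize s.sqrt = r at *
    obtain ⟨d, rfl⟩ := Nat.exists_eq_add_of_le h1
    have hd : d ≤ 2 * r := by nlinarith
    by_cases h : d ≤ r
    · simp [h, shell]
    · have h3 : ¬ (r ≤ 2 * r - d) := by omega
      have e : (r + 1) ^ 2 = r ^ 2 + d + (2 * r - d + 1) := by
        have : 2 * r - d + d = 2 * r := by omega
        linear_combination -this
      simp only [Nat.add_sub_cancel_left, h, if_false, shell, h3]
      omega

/-! ### Hilbert space tensor products -/

section Hilbert

variable (H K : Type*) [NormedAddCommGroup H] [InnerProductSpace ℂ H]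
  [NormedAddCommGroup K] [InnerProductSpace ℂ K]

/-- The Hilbert space tensor product. -/
abbrev HTensor : Type _ := UniformSpace.Completion (H ⊗[ℂ] K)

variable {H K}

/-- The elementary tensor `h ⊗ k`. -/
def htmul (h : H) (k : K) : HTensor H K := ((h ⊗ₜ[ℂ] k : H ⊗[ℂ] K) : HTensor H K)

/-- The bounded operator `a ⊗ b`. -/
def opTensor (a : H →L[ℂ] H) (b : K →L[ℂ] K) : HTensor H K →L[ℂ] HTensor H K :=
  (TensorProduct.mapL a b).completion

@[simp] theorem opTensor_htmul (a : H →L[ℂ] H) (b : K →L[ℂ] K) (h : H) (k : K) :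
    opTensor a b (htmul h k) = htmul (a h) (b k) := by
  simp [opTensor, htmul]

/-- The operator `h ↦ h ⊗ k`. -/
def insRight (k : K) : H →L[ℂ] HTensor H K :=
  UniformSpace.Completion.toComplL ∘L (TensorProduct.mkL ℂ H K).flip k

/-- The operator `k ↦ h ⊗ k`. -/
def insLeft (h : H) : K →L[ℂ] HTensor H K :=
  UniformSpace.Completion.toComplL ∘L TensorProduct.mkL ℂ H K h

@[simp] theorem insRight_apply (h : H) (k : K) : insRight k h = htmul h k := rfl

@[simp] theorem insLeft_apply (h : H) (k : K) : insLeft h k = htmul h k := rfl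

theorem htmul_add_left (h h' : H) (k : K) : htmul (h + h') k = htmul h k + htmul h' k :=
  map_add (insRight k) h h'

theorem htmul_add_right (h : H) (k k' : K) : htmul h (k + k') = htmul h k + htmul h k' :=
  map_add (insLeft h) k k'

theorem htmul_smul_left (c : ℂ) (h : H) (k : K) : htmul (c • h) k = c • htmul h k :=
  map_smul (insRight k) c h

theorem htmul_smul_right (c : ℂ) (h : H) (k : K) : htmul h (c • k) = c • htmul h k :=
  map_smul (insLeft h) c k

theorem inner_htmul (h h' : H) (k k' : K) :
    ⟪htmul h k, htmul h' k'⟫_ℂ = ⟪h, h'⟫_ℂ * ⟪k, k'⟫_ℂ := by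
  rw [htmul, htmul, UniformSpace.Completion.inner_coe, TensorProduct.inner_tmul]

/-- Bounded maps that agree on elementary tensors are equal. -/
theorem ext_htmul {F : Type*} [NormedAddCommGroup F] [NormedSpace ℂ F]
    {S T : HTensor H K →L[ℂ] F} (h : ∀ x y, S (htmul x y) = T (htmul x y)) : S = T := by
  ext z
  induction z using UniformSpace.Completion.induction_on with
  | hp => exact isClosed_eq S.continuous T.continuous
  | ih z =>
    induction z using TensorProduct.induction_on with
    | zero => simp only [UniformSpace.Completion.coe_zero, map_zero]
    | tmul x y => exact h x y
    | add x y hx hy => simp [UniformSpace.Completion.coe_add, hx, hy]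

theorem ext_inner_htmul {x y : HTensor H K}
    (h : ∀ a b, ⟪htmul a b, x⟫_ℂ = ⟪htmul a b, y⟫_ℂ) : x = y := by
  refine ext_inner_left ℂ fun z => ?_
  induction z using UniformSpace.Completion.induction_on with
  | hp => exact isClosed_eq (by fun_prop) (by fun_prop)
  | ih z =>
    induction z using TensorProduct.induction_on with
    | zero => simp only [UniformSpace.Completion.coe_zero, inner_zero_left]
    | tmul a b => exact h a b
    | add a b ha hb => simp only [UniformSpace.Completion.coe_add, inner_add_left, ha, hb]

theorem opTensor_mul (a a' : H →L[ℂ] H) (b b' : K →L[ℂ] K) :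
    opTensor a b * opTensor a' b' = opTensor (a * a') (b * b') :=
  ext_htmul fun x y => by simp

theorem opTensor_comp_insRight (r : H →L[ℂ] H) (k : K) :
    opTensor r 1 ∘L insRight k = insRight k ∘L r := by
  ext; simp

theorem opTensor_comp_insLeft (r : K →L[ℂ] K) (h : H) :
    opTensor 1 r ∘L insLeft h = insLeft h ∘L r := by
  ext; simp

theorem norm_opTensor_le (a : H →L[ℂ] H) (b : K →L[ℂ] K) : ‖opTensor a b‖ ≤ ‖a‖ * ‖b‖ := by
  refine ContinuousLinearMap.opNorm_le_bound _ (by positivity) fun z => ?_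
  induction z using UniformSpace.Completion.induction_on with
  | hp => exact isClosed_le (by fun_prop) (by fun_prop)
  | ih z =>
    simp only [opTensor, ContinuousLinearMap.completion_apply_coe, UniformSpace.Completion.norm_coe]
    exact (ContinuousLinearMap.le_opNorm _ _).trans
      (by gcongr; exact TensorProduct.norm_mapL_le a b)

end Hilbert

/-! ### The tensor product of von Neumann algebras -/

section Algebra

open ContinuousLinearMap (adjoint)

variable {H K : Type*} [NormedAddCommGroup H] [InnerProductSpace ℂ H] [CompleteSpace H]
  [NormedAddCommGroup K] [InnerProductSpace ℂ K] [CompleteSpace K]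

theorem adjoint_opTensor (a : H →L[ℂ] H) (b : K →L[ℂ] K) :
    adjoint (opTensor a b) = opTensor (adjoint a) (adjoint b) := by
  refine ext_htmul fun x y => ext_inner_htmul fun x' y' => ?_
  simp [ContinuousLinearMap.adjoint_inner_right, inner_htmul]

theorem adjoint_insRight_htmul (k : K) (x : H) (y : K) :
    adjoint (insRight (H := H) k) (htmul x y) = ⟪k, y⟫_ℂ • x := by
  refine ext_inner_left ℂ fun z => ?_
  simp [ContinuousLinearMap.adjoint_inner_right, inner_htmul, inner_smul_right, mul_comm]

theorem adjoint_insLeft_htmul (h : H) (x : H) (y : K) :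
    adjoint (insLeft (K := K) h) (htmul x y) = ⟪h, x⟫_ℂ • y := by
  refine ext_inner_left ℂ fun z => ?_
  simp [ContinuousLinearMap.adjoint_inner_right, inner_htmul, inner_smul_right]

/-- The operators `s ⊗ t` with `s ∈ S` and `t ∈ T`. -/
def elemTensors (S : StarSubalgebra ℂ (H →L[ℂ] H)) (T : StarSubalgebra ℂ (K →L[ℂ] K)) :
    Set (HTensor H K →L[ℂ] HTensor H K) :=
  {z | ∃ s ∈ S, ∃ t ∈ T, z = opTensor s t}

theorem star_mem_elemTensors {S : StarSubalgebra ℂ (H →L[ℂ] H)}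
    {T : StarSubalgebra ℂ (K →L[ℂ] K)} {z : HTensor H K →L[ℂ] HTensor H K}
    (hz : z ∈ elemTensors S T) : star z ∈ elemTensors S T := by
  obtain ⟨s, hs, t, ht, rfl⟩ := hz
  exact ⟨star s, star_mem hs, star t, star_mem ht, adjoint_opTensor s t⟩

theorem coe_centralizer_elemTensors (S : StarSubalgebra ℂ (H →L[ℂ] H))
    (T : StarSubalgebra ℂ (K →L[ℂ] K)) :
    (StarSubalgebra.centralizer ℂ (elemTensors S T) : Set (HTensor H K →L[ℂ] HTensor H K)) =
      (elemTensors S T).centralizer := by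
  have h : star (elemTensors S T) ⊆ elemTensors S T := fun z hz => by
    simpa using star_mem_elemTensors (Set.mem_star.1 hz)
  rw [StarSubalgebra.coe_centralizer, Set.union_eq_self_of_subset_right h]

theorem coe_centralizer_centralizer_elemTensors (S : StarSubalgebra ℂ (H →L[ℂ] H))
    (T : StarSubalgebra ℂ (K →L[ℂ] K)) :
    (StarSubalgebra.centralizer ℂ (StarSubalgebra.centralizer ℂ (elemTensors S T) :
      Set (HTensor H K →L[ℂ] HTensor H K)) : Set (HTensor H K →L[ℂ] HTensor H K)) =
      (elemTensors S T).centralizer.centralizer := by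
  rw [StarSubalgebra.coe_centralizer, StarMemClass.star_coe_eq, Set.union_self,
    coe_centralizer_elemTensors]

/-- The von Neumann algebra on the Hilbert space tensor product generated by the operators `s ⊗ t`,
that is, their double commutant. -/
def vnTensor (S : StarSubalgebra ℂ (H →L[ℂ] H)) (T : StarSubalgebra ℂ (K →L[ℂ] K)) :
    VonNeumannAlgebra (HTensor H K) where
  toStarSubalgebra := StarSubalgebra.centralizer ℂ
    (StarSubalgebra.centralizer ℂ (elemTensors S T) : Set (HTensor H K →L[ℂ] HTensor H K))
  centralizer_centralizer' := by
    have h := coe_centralizer_centralizer_elemTensors S T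
    change Set.centralizer (Set.centralizer (StarSubalgebra.centralizer ℂ
      (StarSubalgebra.centralizer ℂ (elemTensors S T) : Set (HTensor H K →L[ℂ] HTensor H K)) :
        Set (HTensor H K →L[ℂ] HTensor H K))) = (StarSubalgebra.centralizer ℂ
      (StarSubalgebra.centralizer ℂ (elemTensors S T) : Set (HTensor H K →L[ℂ] HTensor H K)) :
        Set (HTensor H K →L[ℂ] HTensor H K))
    rw [h, Set.centralizer_centralizer_centralizer]

theorem coe_vnTensor (S : StarSubalgebra ℂ (H →L[ℂ] H)) (T : StarSubalgebra ℂ (K →L[ℂ] K)) :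
    ((vnTensor S T).toStarSubalgebra : Set (HTensor H K →L[ℂ] HTensor H K)) =
      (elemTensors S T).centralizer.centralizer :=
  coe_centralizer_centralizer_elemTensors S T

/-- The product algebra as a type. -/
abbrev VNTensorAlg (S : StarSubalgebra ℂ (H →L[ℂ] H)) (T : StarSubalgebra ℂ (K →L[ℂ] K)) : Type _ :=
  (vnTensor S T).toStarSubalgebra

/-- Compressions `V* z V` of elements of a double commutant, amplified by `ι`, stay in it. -/
theorem compression_mem {L κ : Type*} [NormedAddCommGroup L] [InnerProductSpace ℂ L]
    [CompleteSpace L] (ι : (H →L[ℂ] H) → (L →L[ℂ] L)) (V : κ → H →L[ℂ] L)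
    (hV : ∀ r k, ι r ∘L V k = V k ∘L r) (hV' : ∀ r k, adjoint (V k) ∘L ι r = r ∘L adjoint (V k))
    (hext : ∀ X Y : L →L[ℂ] L,
      (∀ k k', adjoint (V k) ∘L X ∘L V k' = adjoint (V k) ∘L Y ∘L V k') → X = Y)
    (S : Set (H →L[ℂ] H)) (G : Set (L →L[ℂ] L)) (hS : ∀ s ∈ S, ι s ∈ G)
    (hG : ∀ a ∈ S.centralizer, ι a ∈ G.centralizer)
    (z : L →L[ℂ] L) (hz : z ∈ G.centralizer.centralizer) (k₀ : κ) :
    ι (adjoint (V k₀) ∘L z ∘L V k₀) ∈ G.centralizer.centralizer := by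
  have key : ∀ a ∈ S.centralizer,
      a ∘L (adjoint (V k₀) ∘L z ∘L V k₀) = (adjoint (V k₀) ∘L z ∘L V k₀) ∘L a := by
    intro a ha
    have h1 : ι a ∘L z = z ∘L ι a := hz _ (hG a ha)
    calc a ∘L (adjoint (V k₀) ∘L z ∘L V k₀)
        = (a ∘L adjoint (V k₀)) ∘L z ∘L V k₀ := rfl
      _ = adjoint (V k₀) ∘L (ι a ∘L z) ∘L V k₀ := by rw [← hV']; rfl
      _ = adjoint (V k₀) ∘L z ∘L (ι a ∘L V k₀) := by rw [h1]; rfl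
      _ = _ := by rw [hV]; rfl
  intro c hc
  refine hext _ _ fun k k' => ?_
  have hc' : adjoint (V k) ∘L c ∘L V k' ∈ S.centralizer := by
    intro s hs
    have h1 : ι s ∘L c = c ∘L ι s := hc _ (hS s hs)
    change s ∘L (adjoint (V k) ∘L c ∘L V k') = (adjoint (V k) ∘L c ∘L V k') ∘L s
    calc s ∘L (adjoint (V k) ∘L c ∘L V k')
        = (s ∘L adjoint (V k)) ∘L c ∘L V k' := rfl
      _ = adjoint (V k) ∘L (ι s ∘L c) ∘L V k' := by rw [← hV']; rfl
      _ = adjoint (V k) ∘L c ∘L (ι s ∘L V k') := by rw [h1]; rfl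
      _ = _ := by rw [hV]; rfl
  generalize adjoint (V k₀) ∘L z ∘L V k₀ = r at *
  calc adjoint (V k) ∘L (c * ι r) ∘L V k'
      = adjoint (V k) ∘L c ∘L (ι r ∘L V k') := rfl
    _ = (adjoint (V k) ∘L c ∘L V k') ∘L r := by rw [hV]; rfl
    _ = r ∘L (adjoint (V k) ∘L c ∘L V k') := key _ hc'
    _ = (r ∘L adjoint (V k)) ∘L c ∘L V k' := rfl
    _ = adjoint (V k) ∘L (ι r * c) ∘L V k' := by rw [← hV']; rfl

theorem adjoint_insRight_comp_opTensor (r : H →L[ℂ] H) (k : K) :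
    adjoint (insRight k) ∘L opTensor r 1 = r ∘L adjoint (insRight k) :=
  ext_htmul fun x y => by simp [adjoint_insRight_htmul]

theorem adjoint_insLeft_comp_opTensor (r : K →L[ℂ] K) (h : H) :
    adjoint (insLeft h) ∘L opTensor 1 r = r ∘L adjoint (insLeft h) :=
  ext_htmul fun x y => by simp [adjoint_insLeft_htmul]

variable (S : StarSubalgebra ℂ (H →L[ℂ] H)) (T : StarSubalgebra ℂ (K →L[ℂ] K))

theorem compressRight_mem (η : K) (z : VNTensorAlg S T) :
    opTensor (adjoint (insRight η) ∘L z.1 ∘L insRight η) 1 ∈ (vnTensor S T).toStarSubalgebra := by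
  have hz : z.1 ∈ (elemTensors S T).centralizer.centralizer := by
    rw [← coe_vnTensor]; exact z.2
  rw [← SetLike.mem_coe, coe_vnTensor]
  refine compression_mem (fun r => opTensor r 1) (insRight (H := H) (K := K))
    opTensor_comp_insRight adjoint_insRight_comp_opTensor ?_ (S : Set (H →L[ℂ] H)) (elemTensors S T)
    (fun s hs => ⟨s, hs, 1, one_mem T, rfl⟩) ?_ z.1 hz η
  · intro X Y h
    refine ext_htmul fun x y => ext_inner_htmul fun x' y' => ?_
    have := congrArg (fun f => ⟪x', f x⟫_ℂ) (h y' y)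
    simpa [ContinuousLinearMap.adjoint_inner_right] using this
  · rintro a ha _ ⟨s, hs, t, ht, rfl⟩
    rw [opTensor_mul, opTensor_mul, ha s hs, one_mul, mul_one]

theorem compressLeft_mem (ξ : H) (z : VNTensorAlg S T) :
    opTensor 1 (adjoint (insLeft ξ) ∘L z.1 ∘L insLeft ξ) ∈ (vnTensor S T).toStarSubalgebra := by
  have hz : z.1 ∈ (elemTensors S T).centralizer.centralizer := by
    rw [← coe_vnTensor]; exact z.2
  rw [← SetLike.mem_coe, coe_vnTensor]
  refine compression_mem (fun r => opTensor 1 r) (insLeft (H := H) (K := K))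
    opTensor_comp_insLeft adjoint_insLeft_comp_opTensor ?_ (T : Set (K →L[ℂ] K)) (elemTensors S T)
    (fun t ht => ⟨1, one_mem S, t, ht, rfl⟩) ?_ z.1 hz ξ
  · intro X Y h
    refine ext_htmul fun x y => ext_inner_htmul fun x' y' => ?_
    have := congrArg (fun f => ⟪y', f y⟫_ℂ) (h x' x)
    simpa [ContinuousLinearMap.adjoint_inner_right] using this
  · rintro a ha _ ⟨s, hs, t, ht, rfl⟩
    rw [opTensor_mul, opTensor_mul, ha t ht, one_mul, mul_one]

/-- The elementary tensor `s ⊗ t` in the product algebra. -/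
def elemTensor (s : S) (t : T) : VNTensorAlg S T :=
  ⟨opTensor s.1 t.1, by
    rw [← SetLike.mem_coe, coe_vnTensor]
    exact Set.subset_centralizer_centralizer ⟨s.1, s.2, t.1, t.2, rfl⟩⟩

/-- The vector functional `z ↦ ⟨ζ, z ζ⟩` on the product algebra. -/
def vecFunctional (ζ : HTensor H K) : VNTensorAlg S T →L[ℂ] ℂ :=
  LinearMap.mkContinuous
    { toFun := fun z => ⟪ζ, z.1 ζ⟫_ℂ
      map_add' := fun z w => by simp [inner_add_right]
      map_smul' := fun c z => by simp [inner_smul_right] } (‖ζ‖ * ‖ζ‖) fun z => by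
    calc ‖⟪ζ, z.1 ζ⟫_ℂ‖ ≤ ‖ζ‖ * ‖z.1 ζ‖ := norm_inner_le_norm _ _
      _ ≤ ‖ζ‖ * (‖z.1‖ * ‖ζ‖) := by gcongr; exact z.1.le_opNorm ζ
      _ = ‖ζ‖ * ‖ζ‖ * ‖z‖ := by change _ = ‖ζ‖ * ‖ζ‖ * ‖z.1‖; ring

/-- The map `z ↦ (id ⊗ ⟨η, · η⟩)(z) ⊗ 1`: the conditional expectation onto the first factor if `η`
is a unit vector. -/
def condExpFst (η : K) : VNTensorAlg S T →ₗ[ℂ] VNTensorAlg S T where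
  toFun z := ⟨opTensor (adjoint (insRight η) ∘L z.1 ∘L insRight η) 1, compressRight_mem S T η z⟩
  map_add' z w := Subtype.ext <| ext_htmul fun x y => by
    simp [htmul_add_left]
  map_smul' c z := Subtype.ext <| ext_htmul fun x y => by
    simp [htmul_smul_left]

/-- The map `z ↦ 1 ⊗ (⟨ξ, · ξ⟩ ⊗ id)(z)`: the conditional expectation onto the second factor if `ξ`
is a unit vector. -/
def condExpSnd (ξ : H) : VNTensorAlg S T →ₗ[ℂ] VNTensorAlg S T where
  toFun z := ⟨opTensor 1 (adjoint (insLeft ξ) ∘L z.1 ∘L insLeft ξ), compressLeft_mem S T ξ z⟩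
  map_add' z w := Subtype.ext <| ext_htmul fun x y => by
    simp [htmul_add_right]
  map_smul' c z := Subtype.ext <| ext_htmul fun x y => by
    simp [htmul_smul_right]

theorem vecFunctional_mul_condExpFst (ξ : H) (η : K) (x y : VNTensorAlg S T) :
    vecFunctional S T (htmul ξ η) (y * condExpFst S T η x) =
      vecFunctional S T (htmul ξ η) (condExpFst S T η y * x) := by
  have h := congrArg (fun f => ⟪ξ, f (x.1 (htmul ξ η))⟫_ℂ)
    (adjoint_insRight_comp_opTensor (adjoint (insRight η) ∘L y.1 ∘L insRight η) η)
  simp only [ContinuousLinearMap.comp_apply, ContinuousLinearMap.adjoint_inner_right,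
    insRight_apply] at h
  change ⟪htmul ξ η, y.1 (opTensor (adjoint (insRight η) ∘L x.1 ∘L insRight η) 1 (htmul ξ η))⟫_ℂ =
    ⟪htmul ξ η, opTensor (adjoint (insRight η) ∘L y.1 ∘L insRight η) 1 (x.1 (htmul ξ η))⟫_ℂ
  rw [h]
  simp

theorem vecFunctional_mul_condExpSnd (ξ : H) (η : K) (x y : VNTensorAlg S T) :
    vecFunctional S T (htmul ξ η) (y * condExpSnd S T ξ x) =
      vecFunctional S T (htmul ξ η) (condExpSnd S T ξ y * x) := by
  have h := congrArg (fun f => ⟪η, f (x.1 (htmul ξ η))⟫_ℂ)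
    (adjoint_insLeft_comp_opTensor (adjoint (insLeft ξ) ∘L y.1 ∘L insLeft ξ) ξ)
  simp only [ContinuousLinearMap.comp_apply, ContinuousLinearMap.adjoint_inner_right,
    insLeft_apply] at h
  change ⟪htmul ξ η, y.1 (opTensor 1 (adjoint (insLeft ξ) ∘L x.1 ∘L insLeft ξ) (htmul ξ η))⟫_ℂ =
    ⟪htmul ξ η, opTensor 1 (adjoint (insLeft ξ) ∘L y.1 ∘L insLeft ξ) (x.1 (htmul ξ η))⟫_ℂ
  rw [h]
  simp

theorem norm_condExpFst_le (η : K) (y : VNTensorAlg S T) :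
    ‖condExpFst S T η y‖ ≤ ‖adjoint (insRight (H := H) η)‖ * ‖insRight (H := H) η‖ *
      ‖(1 : K →L[ℂ] K)‖ * ‖y‖ := by
  change ‖opTensor (adjoint (insRight η) ∘L y.1 ∘L insRight η) 1‖ ≤ _ * ‖y.1‖
  calc _ ≤ ‖adjoint (insRight η) ∘L y.1 ∘L insRight η‖ * ‖(1 : K →L[ℂ] K)‖ := norm_opTensor_le _ _
    _ ≤ (‖adjoint (insRight (H := H) η)‖ * (‖y.1‖ * ‖insRight (H := H) η‖)) *
        ‖(1 : K →L[ℂ] K)‖ := by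
      gcongr
      refine (ContinuousLinearMap.opNorm_comp_le _ _).trans ?_
      gcongr
      exact ContinuousLinearMap.opNorm_comp_le _ _
    _ = _ := by ring

theorem norm_condExpSnd_le (ξ : H) (y : VNTensorAlg S T) :
    ‖condExpSnd S T ξ y‖ ≤ ‖adjoint (insLeft (K := K) ξ)‖ * ‖insLeft (K := K) ξ‖ *
      ‖(1 : H →L[ℂ] H)‖ * ‖y‖ := by
  change ‖opTensor 1 (adjoint (insLeft ξ) ∘L y.1 ∘L insLeft ξ)‖ ≤ _ * ‖y.1‖
  calc _ ≤ ‖(1 : H →L[ℂ] H)‖ * ‖adjoint (insLeft ξ) ∘L y.1 ∘L insLeft ξ‖ := norm_opTensor_le _ _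
    _ ≤ ‖(1 : H →L[ℂ] H)‖ * (‖adjoint (insLeft (K := K) ξ)‖ *
        (‖y.1‖ * ‖insLeft (K := K) ξ‖)) := by
      gcongr
      refine (ContinuousLinearMap.opNorm_comp_le _ _).trans ?_
      gcongr
      exact ContinuousLinearMap.opNorm_comp_le _ _
    _ = _ := by ring

end Algebra

/-! ### The tensor product of two algebras with states -/

section Product

variable {N M : Type*} [CStarAlgebra N] [PartialOrder N] [StarOrderedRing N]
  [CStarAlgebra M] [PartialOrder M] [StarOrderedRing M] (ρ : N →ₚ[ℂ] ℂ) (φ : M →ₚ[ℂ] ℂ)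

/-- The cyclic vector of the GNS representation. -/
def gnsVec : ρ.GNS := ((ρ.toPreGNS 1 : ρ.PreGNS) : ρ.GNS)

/-- The tensor product von Neumann algebra of `N` and `M`: the von Neumann algebra generated on
`GNS ρ ⊗ GNS φ`, which is the GNS space of `ρ ⊗ φ`, by the operators `a ⊗ b`. -/
abbrev ProdAlg : Type _ := VNTensorAlg ρ.gnsStarAlgHom.range φ.gnsStarAlgHom.range

/-- The elementary tensor `a ⊗ b` in the tensor product von Neumann algebra. -/
def tens (a : N) (b : M) : ProdAlg ρ φ :=
  elemTensor _ _ ⟨ρ.gnsStarAlgHom a, AlgHom.mem_range_self ρ.gnsStarAlgHom.toAlgHom a⟩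
    ⟨φ.gnsStarAlgHom b, AlgHom.mem_range_self φ.gnsStarAlgHom.toAlgHom b⟩

/-- The product state `ρ ⊗ φ`. -/
def prodState : ProdAlg ρ φ →L[ℂ] ℂ :=
  vecFunctional _ _ (htmul (gnsVec ρ) (gnsVec φ))

/-- The conditional expectation of the tensor product onto `N ⊗ 1`. -/
def condExpN : ProdAlg ρ φ →ₗ[ℂ] ProdAlg ρ φ := condExpFst _ _ (gnsVec φ)

/-- The conditional expectation of the tensor product onto `1 ⊗ M`. -/
def condExpM : ProdAlg ρ φ →ₗ[ℂ] ProdAlg ρ φ := condExpSnd _ _ (gnsVec ρ)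

theorem inner_gnsVec (a : N) : ⟪gnsVec ρ, ρ.gnsStarAlgHom a (gnsVec ρ)⟫_ℂ = ρ a := by
  have : ρ.gnsStarAlgHom a (gnsVec ρ) =
      ((ρ.leftMulMapPreGNS a (ρ.toPreGNS 1) : ρ.PreGNS) : ρ.GNS) :=
    ρ.gnsNonUnitalStarAlgHom_apply_coe
  rw [this, gnsVec, UniformSpace.Completion.inner_coe, PositiveLinearMap.preGNS_inner_def]
  simp

theorem prodState_tens (a : N) (b : M) : prodState ρ φ (tens ρ φ a b) = ρ a * φ b := by
  change ⟪htmul (gnsVec ρ) (gnsVec φ), opTensor (ρ.gnsStarAlgHom a) (φ.gnsStarAlgHom b)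
    (htmul (gnsVec ρ) (gnsVec φ))⟫_ℂ = _
  rw [opTensor_htmul, inner_htmul, inner_gnsVec, inner_gnsVec]

theorem condExpN_tens (a : N) (b : M) : condExpN ρ φ (tens ρ φ a b) = φ b • tens ρ φ a 1 := by
  apply Subtype.ext
  change opTensor (ContinuousLinearMap.adjoint (insRight (gnsVec φ)) ∘L
    opTensor (ρ.gnsStarAlgHom a) (φ.gnsStarAlgHom b) ∘L insRight (gnsVec φ)) 1 =
      φ b • opTensor (ρ.gnsStarAlgHom a) (φ.gnsStarAlgHom 1)
  refine ext_htmul fun x y => ?_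
  simp only [opTensor_htmul, ContinuousLinearMap.comp_apply, insRight_apply,
    adjoint_insRight_htmul, inner_gnsVec, htmul_smul_left, map_one]
  simp

theorem condExpM_tens (a : N) (b : M) : condExpM ρ φ (tens ρ φ a b) = ρ a • tens ρ φ 1 b := by
  apply Subtype.ext
  change opTensor 1 (ContinuousLinearMap.adjoint (insLeft (gnsVec ρ)) ∘L
    opTensor (ρ.gnsStarAlgHom a) (φ.gnsStarAlgHom b) ∘L insLeft (gnsVec ρ)) =
      ρ a • opTensor (ρ.gnsStarAlgHom 1) (φ.gnsStarAlgHom b)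
  refine ext_htmul fun x y => ?_
  simp only [opTensor_htmul, ContinuousLinearMap.comp_apply, insLeft_apply,
    adjoint_insLeft_htmul, inner_gnsVec, htmul_smul_right, map_one]
  simp

theorem bounded_condExpN (u : ProdAlg ρ φ) : ∃ C : ℝ, ∀ z,
    ‖leftEmbed (prodState ρ φ) (u * condExpN ρ φ (star u * z))‖ ≤
      C * ‖leftEmbed (prodState ρ φ) z‖ :=
  exists_bound_mul_mul _ _ _ (vecFunctional_mul_condExpFst _ _ (gnsVec ρ) _) _
    (by positivity) (norm_condExpFst_le _ _ (gnsVec φ)) u (star u)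

theorem bounded_condExpM (u : ProdAlg ρ φ) : ∃ C : ℝ, ∀ z,
    ‖leftEmbed (prodState ρ φ) (u * condExpM ρ φ (star u * z))‖ ≤
      C * ‖leftEmbed (prodState ρ φ) z‖ :=
  exists_bound_mul_mul _ _ _ (vecFunctional_mul_condExpSnd _ _ _ (gnsVec φ)) _
    (by positivity) (norm_condExpSnd_le _ _ (gnsVec ρ)) u (star u)

/-- The operator `z ↦ (1 ⊗ b) E_N((1 ⊗ b)* z)`, extended to the left predual of the product. -/
def assocProjM (b : M) : Sharp (prodState ρ φ) →L[ℂ] Sharp (prodState ρ φ) :=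
  extendSharp (prodState ρ φ)
    (LinearMap.mulLeft ℂ (tens ρ φ 1 b) ∘ₗ condExpN ρ φ ∘ₗ LinearMap.mulLeft ℂ (star (tens ρ φ 1 b)))
    (bounded_condExpN ρ φ (tens ρ φ 1 b))

/-- The operator `z ↦ (a ⊗ 1) E_M((a ⊗ 1)* z)`, extended to the left predual of the product. -/
def assocProjN (a : N) : Sharp (prodState ρ φ) →L[ℂ] Sharp (prodState ρ φ) :=
  extendSharp (prodState ρ φ)
    (LinearMap.mulLeft ℂ (tens ρ φ a 1) ∘ₗ condExpM ρ φ ∘ₗ LinearMap.mulLeft ℂ (star (tens ρ φ a 1)))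
    (bounded_condExpM ρ φ (tens ρ φ a 1))

end Product

end VNTensor

end

namespace VNTensor

open Filter Topology

/-! ### Commuting Schauder decompositions summed along shells. -/

section Decomposition

variable {X : Type*} [NormedAddCommGroup X] [NormedSpace ℂ X]

/-! Let `ξ`, `η` be the cyclic vectors. `E_M` compresses the first tensor factor by `ξ` and `E_N`
compresses the second by `η`. Applying both leaves only a scalar, so `E j D k` and `D k E j` are the
same operator of rank one, `z ↦ (ρ ⊗ φ)((x j ⊗ y k)* z) • (x j ⊗ y k)`. In particular the two
decompositions commute. The scalars extend to bounded functionals on the completion, and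
orthonormality makes them biorthogonal to the elementary tensors (`extendSharp_extendSharp`,
`tens_mul_condExpM_tens_mul_condExpN` and its mirror image).

What remains is a fact about Banach spaces (`tendsto_sum_shell`): if `E` and `D` commute, `∑ E j D k
z` converges to `z` along shells. By Banach-Steinhaus the partial sums of `E` and `D` are bounded by
constants `A` and `B`. After `r ^ 2` terms the shell sum is the `r`-th partial sum of `E` applied to
that of `D`, and these products converge strongly to the identity. Between two squares the excess is
an initial segment of the column `k = r`, at most `A * ‖D r z‖`, plus a difference of two initial
segments of the row `j = r`, at most `2 * B * ‖E r z‖`. Both bounds tend to zero, being multiples of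
the norms of terms of convergent series. -/

theorem shellEquiv_symm_sq_add_of_le {r d : ℕ} (h : d ≤ r) :
    shellEquiv.symm (r ^ 2 + d) = (d, r) := by
  rw [Equiv.symm_apply_eq]
  simp [shellEquiv, shell, h]

theorem shellEquiv_symm_sq_add_of_lt {r k : ℕ} (h : k < r) :
    shellEquiv.symm (r ^ 2 + (2 * r - k)) = (r, k) := by
  rw [Equiv.symm_apply_eq]
  have e : (r + 1) ^ 2 = r ^ 2 + (2 * r - k) + (k + 1) := by
    have : 2 * r - k + k = 2 * r := by omega
    linear_combination -this
  simp [shellEquiv, shell, not_le.2 h, e]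

/-- The partial sums of a Schauder decomposition are uniformly bounded. -/
theorem IsSchauderDecomposition.exists_norm_sum_le [CompleteSpace X] {D : ℕ → X →L[ℂ] X}
    (hD : IsSchauderDecomposition D) :
    ∃ C : ℝ, 0 ≤ C ∧ ∀ n z, ‖∑ j ∈ Finset.range n, D j z‖ ≤ C * ‖z‖ := by
  -- Pointwise boundedness holds because the partial sums at each `z` converge.
  obtain ⟨C, hC⟩ := banach_steinhaus (g := fun n => ∑ j ∈ Finset.range n, D j) fun z => by
    obtain ⟨M, hM⟩ := isBounded_iff_forall_norm_le.1
      (Metric.isBounded_range_of_tendsto _ (hD.expansion z))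
    exact ⟨M, fun n => by simpa using hM _ ⟨n, rfl⟩⟩
  refine ⟨C, (norm_nonneg _).trans (hC 0), fun n z => ?_⟩
  simpa using ContinuousLinearMap.le_of_opNorm_le _ (hC n) z

theorem IsSchauderDecomposition.tendsto_zero {D : ℕ → X →L[ℂ] X}
    (hD : IsSchauderDecomposition D) (z : X) : Tendsto (fun n => D n z) atTop (𝓝 0) := by
  have h := ((tendsto_add_atTop_iff_nat 1).2 (hD.expansion z)).sub (hD.expansion z)
  simpa [Finset.sum_range_succ] using h

/-- The partial sums along the first half of a shell. -/
theorem sum_shell_add_of_le {r d : ℕ} (h : d ≤ r + 1) (g : ℕ × ℕ → X) :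
    ∑ s ∈ Finset.range (r ^ 2 + d), g (shellEquiv.symm s) =
      ∑ s ∈ Finset.range (r ^ 2), g (shellEquiv.symm s) + ∑ j ∈ Finset.range d, g (j, r) := by
  rw [Finset.sum_range_add]
  congr 1
  refine Finset.sum_congr rfl fun j hj => ?_
  rw [shellEquiv_symm_sq_add_of_le (by have := Finset.mem_range.1 hj; omega)]

/-- The partial sums along the second half of a shell. -/
theorem sum_shell_add_of_lt {r m : ℕ} (h : m ≤ r) (g : ℕ × ℕ → X) :
    ∑ s ∈ Finset.range (r ^ 2 + (2 * r + 1 - m)), g (shellEquiv.symm s) =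
      ∑ s ∈ Finset.range (r ^ 2), g (shellEquiv.symm s) + ∑ j ∈ Finset.range (r + 1), g (j, r) +
        (∑ k ∈ Finset.range r, g (r, k) - ∑ k ∈ Finset.range m, g (r, k)) := by
  -- After the column `k = r`, corner included, the shell runs through `(r, k)` with `k` descending
  -- from `r - 1`. Here `m` counts the entries not yet reached, so those visited have `m ≤ k < r`, a
  -- difference of two initial segments. The induction starts at `m = r`, where only the column is
  -- complete, and each step down adds the entry `(r, m)`.
  induction h using Nat.decreasingInduction with
  | self => rw [sub_self, add_zero, ← sum_shell_add_of_le le_rfl]; congr 3; omega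
  | of_succ m hm ih =>
    rw [show 2 * r + 1 - m = 2 * r + 1 - (m + 1) + 1 by omega, ← add_assoc,
      Finset.sum_range_succ, ih, Finset.sum_range_succ _ m,
      show 2 * r + 1 - (m + 1) = 2 * r - m by omega, shellEquiv_symm_sq_add_of_lt hm]
    abel

/-- The case `m = 0` of `sum_shell_add_of_lt` is a full shell, which enlarges the square of side `r`
to that of side `r + 1`. -/
theorem sum_shell_sq (r : ℕ) (g : ℕ × ℕ → X) :
    ∑ s ∈ Finset.range (r ^ 2), g (shellEquiv.symm s) =
      ∑ j ∈ Finset.range r, ∑ k ∈ Finset.range r, g (j, k) := by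
  induction r with
  | zero => simp
  | succ r ih =>
    have h := sum_shell_add_of_lt (Nat.zero_le r) g
    rw [show r ^ 2 + (2 * r + 1 - 0) = (r + 1) ^ 2 by rw [Nat.sub_zero]; ring, ih] at h
    rw [h]
    simp only [Finset.sum_range_succ, Finset.sum_add_distrib, Finset.sum_range_zero, sub_zero]
    abel

variable {E D : ℕ → X →L[ℂ] X}

/-- For two commuting Schauder decompositions, the double series `∑ E j D k z` converges to `z`
along the shell enumeration. -/
theorem tendsto_sum_shell [CompleteSpace X] (hE : IsSchauderDecomposition E)
    (hD : IsSchauderDecomposition D) (hcomm : ∀ j k z, E j (D k z) = D k (E j z)) (z : X) :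
    Tendsto (fun n => ∑ s ∈ Finset.range n,
      E (shellEquiv.symm s).1 (D (shellEquiv.symm s).2 z)) atTop (𝓝 z) := by
  obtain ⟨A, hA0, hA⟩ := hE.exists_norm_sum_le
  obtain ⟨B, hB0, hB⟩ := hD.exists_norm_sum_le
  set g : ℕ × ℕ → X := fun p => E p.1 (D p.2 z) with hg
  set Q : ℕ → X := fun r => ∑ j ∈ Finset.range r, ∑ k ∈ Finset.range r, g (j, k) with hQ
  have hQz : Tendsto Q atTop (𝓝 z) := by
    have h0 : Tendsto (fun r => A * ‖∑ k ∈ Finset.range r, D k z - z‖ +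
        ‖∑ j ∈ Finset.range r, E j z - z‖) atTop (𝓝 0) := by
      simpa using ((tendsto_iff_norm_sub_tendsto_zero.1 (hD.expansion z)).const_mul A).add
        (tendsto_iff_norm_sub_tendsto_zero.1 (hE.expansion z))
    refine tendsto_iff_norm_sub_tendsto_zero.2
      (squeeze_zero (fun _ => norm_nonneg _) (fun r => ?_) h0)
    -- The square sum is the partial sum of `E` applied to the partial sum of `D`. Inserting the
    -- partial sum of `E` at `z` leaves a first term controlled by the uniform bound `A` and a
    -- second that is the error of `E` alone.
    have e : Q r - z = ∑ j ∈ Finset.range r, E j (∑ k ∈ Finset.range r, D k z - z) +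
        (∑ j ∈ Finset.range r, E j z - z) := by
      simp [hQ, hg, map_sub, map_sum]
    rw [e]
    exact (norm_add_le _ _).trans (add_le_add_left (hA _ _) _)
  -- A column segment is a partial sum of `E` at the fixed vector `D r z`. For a row segment,
  -- commutation is needed to see it as a partial sum of `D` at `E r z`.
  have hfirst : ∀ d r, ‖∑ j ∈ Finset.range d, g (j, r)‖ ≤ A * ‖D r z‖ := fun d r => hA d (D r z)
  have hsecond : ∀ m r, ‖∑ k ∈ Finset.range m, g (r, k)‖ ≤ B * ‖E r z‖ := fun m r => by
    simpa only [hg, hcomm] using hB m (E r z)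
  have hbound : ∀ n, ‖∑ s ∈ Finset.range n, g (shellEquiv.symm s) - Q n.sqrt‖ ≤
      A * ‖D n.sqrt z‖ + (B * ‖E n.sqrt z‖ + B * ‖E n.sqrt z‖) := by
    intro n
    obtain ⟨h1, h2⟩ := Nat.eq_sqrt'.1 (rfl : n.sqrt = n.sqrt)
    generalize n.sqrt = r at *
    obtain ⟨d, rfl⟩ := Nat.exists_eq_add_of_le h1
    have hd : d ≤ 2 * r := by nlinarith
    -- Here `r = n.sqrt` and `n = r ^ 2 + d`. The column has `r + 1` entries, so up to `d = r + 1`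
    -- no entry of the row occurs. Beyond that `m = 2 * r + 1 - d` entries of the row are still
    -- missing.
    by_cases h : d ≤ r + 1
    · rw [sum_shell_add_of_le h, sum_shell_sq, add_sub_cancel_left]
      exact (hfirst d r).trans (le_add_of_nonneg_right (by positivity))
    · obtain ⟨m, hm, rfl⟩ : ∃ m ≤ r, d = 2 * r + 1 - m := ⟨2 * r + 1 - d, by omega, by omega⟩
      rw [sum_shell_add_of_lt hm, sum_shell_sq, add_assoc, add_sub_cancel_left]
      exact (norm_add_le _ _).trans (add_le_add (hfirst _ _)
        ((norm_sub_le _ _).trans (add_le_add (hsecond _ _) (hsecond _ _))))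
  have hsqrt : Tendsto Nat.sqrt atTop atTop :=
    tendsto_atTop.2 fun r => (eventually_ge_atTop (r ^ 2)).mono fun n hn => Nat.le_sqrt'.2 hn
  have h0 : Tendsto (fun r => A * ‖D r z‖ + (B * ‖E r z‖ + B * ‖E r z‖)) atTop (𝓝 0) := by
    have hDz := (hD.tendsto_zero z).norm.const_mul A
    have hEz := (hE.tendsto_zero z).norm.const_mul B
    simpa using hDz.add (hEz.add hEz)
  simpa using (squeeze_zero_norm hbound (h0.comp hsqrt)).add (hQz.comp hsqrt)

/-- If `E j D k = D k E j` is the projection of rank one `f (j, k) ⊗ u (j, k)`, then the `u (j, k)`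
in the shell enumeration are a Schauder basis. -/
theorem isSchauderBasis_shell [CompleteSpace X] (hE : IsSchauderDecomposition E)
    (hD : IsSchauderDecomposition D) (u : ℕ × ℕ → X) (f : ℕ × ℕ → StrongDual ℂ X)
    (hf : ∀ p q, f p (u q) = if p = q then 1 else 0)
    (hED : ∀ j k z, E j (D k z) = f (j, k) z • u (j, k))
    (hDE : ∀ j k z, D k (E j z) = f (j, k) z • u (j, k)) :
    IsSchauderBasis fun s => u (shellEquiv.symm s) := by
  refine ⟨⟨fun s => u (shellEquiv.symm s), fun s => f (shellEquiv.symm s), fun i j => ?_,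
    fun z => ?_⟩, rfl⟩
  · simp only [hf, Pi.single_apply, shellEquiv.symm.injective.eq_iff]
    split_ifs <;> rfl
  -- The expansion in a Schauder basis is conditional: only the partial sums over initial segments
  -- `range n` have to converge.
  · rw [HasSum, SummationFilter.conditional_filter_eq_map_range, tendsto_map'_iff]
    simpa [hED, Function.comp_def] using
      tendsto_sum_shell hE hD (fun j k z => (hED j k z).trans (hDE j k z).symm) z

end Decomposition

/-! ### Coefficient functionals and rank-one operators on the left predual. -/

section Coordinates

variable {A : Type*} [NormedRing A] [NormedAlgebra ℂ A]

/-- The functional `z ↦ ω(v z)`, extended to `A_♯`. -/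
noncomputable def coordSharp (ω : A →L[ℂ] ℂ) (v : A) : StrongDual ℂ (Sharp ω) :=
  (LinearMap.mkContinuous
    ((ω.toLinearMap ∘ₗ LinearMap.mulLeft ℂ v) ∘ₗ (toPreSharp ω).symm.toLinearMap) ‖v‖
    -- `ω (v * z)` is the value at `v` of the functional whose dual norm is `‖z‖_♯`, whence the
    -- bound `‖v‖`.
    fun z => by
      rw [mul_comm]
      exact (leftEmbed ω ((toPreSharp ω).symm z)).le_opNorm v).extend
    UniformSpace.Completion.toComplL

theorem coordSharp_toSharp (ω : A →L[ℂ] ℂ) (v z : A) :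
    coordSharp ω v (toSharp ω z) = ω (v * z) :=
  ContinuousLinearMap.extend_eq _ UniformSpace.Completion.denseRange_coe
    (UniformSpace.Completion.isUniformInducing_coe _) _

theorem toSharp_smul (ω : A →L[ℂ] ℂ) (c : ℂ) (z : A) :
    toSharp ω (c • z) = c • toSharp ω z := by
  rw [toSharp, map_smul, UniformSpace.Completion.coe_smul, toSharp]

/-- Extensions to `A_♯` that compose to an operator of rank one on `A` do so on `A_♯`. -/
theorem extendSharp_extendSharp (ω : A →L[ℂ] ℂ) (T T' : A →ₗ[ℂ] A)
    (hT : ∃ C : ℝ, ∀ x, ‖leftEmbed ω (T x)‖ ≤ C * ‖leftEmbed ω x‖)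
    (hT' : ∃ C : ℝ, ∀ x, ‖leftEmbed ω (T' x)‖ ≤ C * ‖leftEmbed ω x‖) (v u : A)
    (h : ∀ z, T (T' z) = ω (v * z) • u) (z : Sharp ω) :
    extendSharp ω T hT (extendSharp ω T' hT' z) = coordSharp ω v z • toSharp ω u := by
  have key (z : A) : extendSharp ω T hT (extendSharp ω T' hT' (toSharp ω z)) =
      coordSharp ω v (toSharp ω z) • toSharp ω u := by
    rw [extendSharp_toSharp, extendSharp_toSharp, coordSharp_toSharp, ← toSharp_smul, h]
  -- Both sides are continuous and agree on the dense image of `A`.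
  exact congrFun (UniformSpace.Completion.ext
    (f := fun z => extendSharp ω T hT (extendSharp ω T' hT' z))
    (g := fun z => coordSharp ω v z • toSharp ω u) (by fun_prop) (by fun_prop) key) z

end Coordinates

/-! ### The rank-one identity in the tensor product algebra. -/

section Product

variable {N M : Type*} [CStarAlgebra N] [PartialOrder N] [StarOrderedRing N]
  [CStarAlgebra M] [PartialOrder M] [StarOrderedRing M] (ρ : N →ₚ[ℂ] ℂ) (φ : M →ₚ[ℂ] ℂ)

open ContinuousLinearMap (adjoint)

theorem adjoint_one {H : Type*} [NormedAddCommGroup H] [InnerProductSpace ℂ H] [CompleteSpace H] :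
    adjoint (1 : H →L[ℂ] H) = 1 :=
  star_one _

theorem tens_mul_tens (a a' : N) (b b' : M) :
    tens ρ φ a b * tens ρ φ a' b' = tens ρ φ (a * a') (b * b') := by
  apply Subtype.ext
  change opTensor (ρ.gnsStarAlgHom a) (φ.gnsStarAlgHom b) *
    opTensor (ρ.gnsStarAlgHom a') (φ.gnsStarAlgHom b') =
      opTensor (ρ.gnsStarAlgHom (a * a')) (φ.gnsStarAlgHom (b * b'))
  rw [opTensor_mul, map_mul, map_mul]

theorem star_tens (a : N) (b : M) : star (tens ρ φ a b) = tens ρ φ (star a) (star b) := by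
  apply Subtype.ext
  change adjoint (opTensor (ρ.gnsStarAlgHom a) (φ.gnsStarAlgHom b)) =
    opTensor (ρ.gnsStarAlgHom (star a)) (φ.gnsStarAlgHom (star b))
  rw [adjoint_opTensor, map_star, map_star]
  rfl

/-- This writes the coefficient of `z` at `a ⊗ b` as a matrix coefficient at the cyclic product
vector, the form in which the two compressions produce it. -/
theorem prodState_star_tens_mul (a : N) (b : M) (z : ProdAlg ρ φ) :
    prodState ρ φ (star (tens ρ φ a b) * z) =
      ⟪htmul (ρ.gnsStarAlgHom a (gnsVec ρ)) (φ.gnsStarAlgHom b (gnsVec φ)),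
        z.1 (htmul (gnsVec ρ) (gnsVec φ))⟫_ℂ := by
  change ⟪htmul (gnsVec ρ) (gnsVec φ), adjoint (opTensor (ρ.gnsStarAlgHom a) (φ.gnsStarAlgHom b))
    (z.1 (htmul (gnsVec ρ) (gnsVec φ)))⟫_ℂ = _
  rw [ContinuousLinearMap.adjoint_inner_right, opTensor_htmul]

/-- Compressing by `η` gives `E_N((1 ⊗ b)* z) = c ⊗ 1` for an operator `c`, so `E_M` is applied to
`a* c ⊗ b` and returns `⟨aξ, cξ⟩ • (1 ⊗ b)`. By the definition of `c`, this scalar is `⟨aξ ⊗ bη, z(ξ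
⊗ η)⟩`. -/
theorem tens_mul_condExpM_tens_mul_condExpN (a : N) (b : M) (z : ProdAlg ρ φ) :
    tens ρ φ a 1 * condExpM ρ φ (star (tens ρ φ a 1) *
        (tens ρ φ 1 b * condExpN ρ φ (star (tens ρ φ 1 b) * z))) =
      prodState ρ φ (star (tens ρ φ a b) * z) • tens ρ φ a b := by
  rw [prodState_star_tens_mul]
  apply Subtype.ext
  refine ext_htmul fun h k => ?_
  change opTensor (ρ.gnsStarAlgHom a) (φ.gnsStarAlgHom 1) (opTensor 1 (adjoint (insLeft (gnsVec ρ))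
    ∘L (adjoint (opTensor (ρ.gnsStarAlgHom a) (φ.gnsStarAlgHom 1)) ∘L
      opTensor (ρ.gnsStarAlgHom 1) (φ.gnsStarAlgHom b) ∘L opTensor (adjoint (insRight (gnsVec φ)) ∘L
        (adjoint (opTensor (ρ.gnsStarAlgHom 1) (φ.gnsStarAlgHom b)) ∘L z.1) ∘L
          insRight (gnsVec φ)) 1) ∘L insLeft (gnsVec ρ)) (htmul h k)) =
    (⟪htmul (ρ.gnsStarAlgHom a (gnsVec ρ)) (φ.gnsStarAlgHom b (gnsVec φ)),
      z.1 (htmul (gnsVec ρ) (gnsVec φ))⟫_ℂ) •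
        opTensor (ρ.gnsStarAlgHom a) (φ.gnsStarAlgHom b) (htmul h k)
  simp only [map_one, adjoint_opTensor, ContinuousLinearMap.comp_apply, opTensor_htmul,
    insLeft_apply, insRight_apply, adjoint_insLeft_htmul, htmul_smul_right]
  -- The remaining adjoint acts on the vector `z (ξ ⊗ η)`, which need not be an elementary tensor.
  -- It is restored to the form `adjoint (opTensor _ _)` so that it can move to the other side of
  -- the inner product.
  rw [← adjoint_opTensor]
  simp [ContinuousLinearMap.adjoint_inner_right, adjoint_one]

/-- With the compressions in the other order the scalar is the same matrix coefficient, which is why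
the two decompositions commute. -/
theorem tens_mul_condExpN_tens_mul_condExpM (a : N) (b : M) (z : ProdAlg ρ φ) :
    tens ρ φ 1 b * condExpN ρ φ (star (tens ρ φ 1 b) *
        (tens ρ φ a 1 * condExpM ρ φ (star (tens ρ φ a 1) * z))) =
      prodState ρ φ (star (tens ρ φ a b) * z) • tens ρ φ a b := by
  rw [prodState_star_tens_mul]
  apply Subtype.ext
  refine ext_htmul fun h k => ?_
  change opTensor (ρ.gnsStarAlgHom 1) (φ.gnsStarAlgHom b) (opTensor (adjoint (insRight (gnsVec φ))
    ∘L (adjoint (opTensor (ρ.gnsStarAlgHom 1) (φ.gnsStarAlgHom b)) ∘L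
      opTensor (ρ.gnsStarAlgHom a) (φ.gnsStarAlgHom 1) ∘L opTensor 1 (adjoint (insLeft (gnsVec ρ)) ∘L
        (adjoint (opTensor (ρ.gnsStarAlgHom a) (φ.gnsStarAlgHom 1)) ∘L z.1) ∘L
          insLeft (gnsVec ρ))) ∘L insRight (gnsVec φ)) 1 (htmul h k)) =
    (⟪htmul (ρ.gnsStarAlgHom a (gnsVec ρ)) (φ.gnsStarAlgHom b (gnsVec φ)),
      z.1 (htmul (gnsVec ρ) (gnsVec φ))⟫_ℂ) •
        opTensor (ρ.gnsStarAlgHom a) (φ.gnsStarAlgHom b) (htmul h k)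
  simp only [map_one, adjoint_opTensor, ContinuousLinearMap.comp_apply, opTensor_htmul,
    insLeft_apply, insRight_apply, adjoint_insRight_htmul, htmul_smul_left]
  rw [← adjoint_opTensor]
  simp [ContinuousLinearMap.adjoint_inner_right, adjoint_one]

theorem assocProjN_assocProjM (a : N) (b : M) (z : Sharp (prodState ρ φ)) :
    assocProjN ρ φ a (assocProjM ρ φ b z) =
      coordSharp (prodState ρ φ) (star (tens ρ φ a b)) z •
        toSharp (prodState ρ φ) (tens ρ φ a b) :=
  extendSharp_extendSharp _ _ _ _ _ _ _ (tens_mul_condExpM_tens_mul_condExpN ρ φ a b) z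

theorem assocProjM_assocProjN (a : N) (b : M) (z : Sharp (prodState ρ φ)) :
    assocProjM ρ φ b (assocProjN ρ φ a z) =
      coordSharp (prodState ρ φ) (star (tens ρ φ a b)) z •
        toSharp (prodState ρ φ) (tens ρ φ a b) :=
  extendSharp_extendSharp _ _ _ _ _ _ _ (tens_mul_condExpN_tens_mul_condExpM ρ φ a b) z

end Product

end VNTensor

theorem mainTheorem8 {N M : Type*}
    [CStarAlgebra N] [WStarAlgebra N] [PartialOrder N] [StarOrderedRing N]
    [CStarAlgebra M] [WStarAlgebra M] [PartialOrder M] [StarOrderedRing M]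
    (ρ : N →ₚ[ℂ] ℂ) (φ : M →ₚ[ℂ] ℂ)
    (hρ : VNTensor.IsFaithfulNormalState ρ) (hφ : VNTensor.IsFaithfulNormalState φ)
    (x : ℕ → N) (y : ℕ → M)
    (hx_orth : ∀ j k, ρ (star (x j) * x k) = if j = k then 1 else 0)
    (hy_orth : ∀ j k, φ (star (y j) * y k) = if j = k then 1 else 0)
    (hx : VNTensor.IsSchauderBasis fun j => VNTensor.toSharp (VNTensor.toCLM ρ) (x j))
    (hy : VNTensor.IsSchauderBasis fun k => VNTensor.toSharp (VNTensor.toCLM φ) (y k))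
    (hE : VNTensor.IsSchauderDecomposition fun j => VNTensor.assocProjN ρ φ (x j))
    (hD : VNTensor.IsSchauderDecomposition fun k => VNTensor.assocProjM ρ φ (y k)) :
    VNTensor.IsSchauderBasis fun s =>
      VNTensor.toSharp (VNTensor.prodState ρ φ)
        (VNTensor.tens ρ φ (x (VNTensor.shellEquiv.symm s).1) (y (VNTensor.shellEquiv.symm s).2)) := by
  refine VNTensor.isSchauderBasis_shell hE hD
    (fun p => VNTensor.toSharp _ (VNTensor.tens ρ φ (x p.1) (y p.2)))
    (fun p => VNTensor.coordSharp _ (star (VNTensor.tens ρ φ (x p.1) (y p.2))))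
    (fun p q => ?_) (fun j k => VNTensor.assocProjN_assocProjM ρ φ (x j) (y k))
    (fun j k => VNTensor.assocProjM_assocProjN ρ φ (x j) (y k))
  -- Biorthogonality: the product state factors on elementary tensors, so the pairing is `ρ (x j* x
  -- j') * φ (y k* y k')`, a product of two Kronecker deltas.
  rw [VNTensor.coordSharp_toSharp, VNTensor.star_tens, VNTensor.tens_mul_tens,
    VNTensor.prodState_tens, hx_orth, hy_orth]
  simp only [Prod.ext_iff, ite_and, mul_ite, mul_one, mul_zero]
  split_ifs <;> rfl
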